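/- Let $n\ge 1$ and let $I_{[n]}=\{0,1\}^n$. For ${\bf i}\in I_{[n]}$ let $\bar{\bf i}$ be the index obtained from ${\bf i}$ by switching all its digits, and put $z^{\bf i}=\prod_{k=1}^n z_k^{1-2{\bf i}(k)}$ for $z\in(\mathbb C\setminus\{0\})^n$. Let $\mathcal V_n^+$ be the set of functions $I_{[n]}\to[0,\infty)$, and let $\mathcal V_n^{\rm sa}$ be the real vector space of functions $u:I_{[n]}\to\mathbb C$ with $u_{\bar{\bf i}}=\overline{u_{\bf i}}$ for all ${\bf i}$. For $s\in\mathcal V_n^+$ and $u\in\mathcal V_n^{\rm sa}$ let $X(s,u)\in M_2(\mathbb C)^{\otimes n}$ be the matrix, with rows and columns indexed by $I_{[n]}$, whose $({\bf i},{\bf i})$ entry is $s_{\bf i}$, whose $({\bf i},\bar{\bf i})$ entry is $u_{\bf i}$, and all of whose other entries are $0$. Define $$\delta_n(s)=\inf_{r\in(0,\infty)^n}\sum_{{\bf i}} s_{\bf i}r^{\bf i},\qquad \|u\|_{X_n}=\sup_{\alpha\in\mathbb T^n}\sum_{{\bf i}}u_{\bf i}\alpha^{\bf i},$$ where $\mathbb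 T$ is the unit circle in $\mathbb C$ (the latter sums are real), and, for $a\in\mathcal V_n^+$ and $c\in\mathcal V_n^{\rm sa}$, $$\Delta_n(a)=\inf\Big\{\sum_{\bf i}s_{\bf i}a_{\bf i}: s\in\mathcal V_n^+,\ \delta_n(s)=1\Big\},\qquad \|c\|'_{X_n}=\sup\Big\{\sum_{\bf i}u_{\bf i}c_{\bf i}: u\in\mathcal V_n^{\rm sa},\ \|u\|_{X_n}=1\Big\}.$$ **Theorem.** Let $a\in\mathcal V_n^+$ and $c\in\mathcal V_n^{\rm sa}$ be such that $\varrho=X(a,c)$ is an $n$-qubit state, that is, positive semidefinite (its trace need not be normalized to one). Then $\varrho$ is (fully) separable, that is, a finite sum $\sum_l p_l\,|\psi_l\rangle\langle\psi_l|$ with $p_l\ge 0$ and $\psi_l=x_{l,1}\otimes\cdots\otimes x_{l,n}$ a product of unit vectors in $\mathbb C^2$, if and only if $$\Delta_n(a)\ \ge\ \|c\|'_{X_n}.$$ If $\varrho$ has trace one, then $\sum_l p_l=1$ in any such sum, so separability means being a convex combination of pure product states. -/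

import Mathlib

open scoped ComplexOrder

noncomputable section

namespace XState

/-- `n`-bit indices: functions from `{1, …, n}` to `{0, 1}`. -/
abbrev Idx (n : ℕ) : Type := Fin n → Fin 2

/-- The index `ī`, obtained from `i` by switching all the digits (addition in `Fin 2` is mod 2). -/
def flip {n : ℕ} (i : Idx n) : Idx n := fun k => i k + 1

/-- The nonnegative real functions on the set of `n`-bit indices. -/
def nonnegFun (n : ℕ) : Set (Idx n → ℝ) := {s | ∀ i, 0 ≤ s i}

/-- The complex functions `u` on the set of `n`-bit indices with `u_ī = conj (u_i)` for all `i`. -/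
def saFun (n : ℕ) : Set (Idx n → ℂ) := {u | ∀ i, u (flip i) = star (u i)}

/-- The X-shaped `n`-qubit matrix `X(s, u)`, with diagonal `s` and anti-diagonal `u`. The algebra
`M₂ ⊗ ⋯ ⊗ M₂` is identified with the matrices indexed by `n`-bit indices, the standard product
basis vectors being indexed by these. -/
def xMatrix {n : ℕ} (s : Idx n → ℝ) (u : Idx n → ℂ) : Matrix (Idx n) (Idx n) ℂ :=
  Matrix.of fun i j => if j = i then (s i : ℂ) else if j = flip i then u i else 0

/-- The monomial `z^i = ∏ₖ zₖ ^ (1 - 2 i(k))`. -/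
def monom {K : Type*} [Field K] {n : ℕ} (z : Fin n → K) (i : Idx n) : K :=
  ∏ k, z k ^ (1 - 2 * ((i k : ℕ) : ℤ))

/-- `δₙ(s) = inf { ∑ᵢ sᵢ r^i : r ∈ (0, ∞)ⁿ }`. -/
def delta {n : ℕ} (s : Idx n → ℝ) : ℝ :=
  sInf {t : ℝ | ∃ r : Fin n → ℝ, (∀ k, 0 < r k) ∧ t = ∑ i, s i * monom r i}

/-- `‖u‖_{Xₙ} = sup { ∑ᵢ uᵢ α^i : α ∈ 𝕋ⁿ }`. For `u ∈ saFun n` the sums are real numbers, so that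
taking real parts only changes the type. -/
def xNorm {n : ℕ} (u : Idx n → ℂ) : ℝ :=
  sSup {t : ℝ | ∃ α : Fin n → ℂ, (∀ k, ‖α k‖ = 1) ∧ t = (∑ i, u i * monom α i).re}

/-- `Δₙ(a) = inf { ⟨s, a⟩ : s ≥ 0, δₙ(s) = 1 }`. -/
def Delta {n : ℕ} (a : Idx n → ℝ) : ℝ :=
  sInf {t : ℝ | ∃ s ∈ nonnegFun n, delta s = 1 ∧ t = ∑ i, s i * a i}

/-- The dual norm `‖c‖'_{Xₙ} = sup { ⟨u, c⟩ : u ∈ saFun n, ‖u‖_{Xₙ} = 1 }` for the bilinear pairing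
`⟨u, c⟩ = ∑ᵢ uᵢ cᵢ`, which is real for `u, c ∈ saFun n`. -/
def xDualNorm {n : ℕ} (c : Idx n → ℂ) : ℝ :=
  sSup {t : ℝ | ∃ u ∈ saFun n, xNorm u = 1 ∧ t = (∑ i, u i * c i).re}

/-- The product vector `x₁ ⊗ ⋯ ⊗ xₙ` of vectors in `ℂ²`, in coordinates. -/
def productVec {n : ℕ} (x : Fin n → EuclideanSpace ℂ (Fin 2)) : Idx n → ℂ :=
  fun i => ∏ k, x k (i k)

/-- The pure state `|ψ⟩⟨ψ|`. -/
def rankOne {n : ℕ} (ψ : Idx n → ℂ) : Matrix (Idx n) (Idx n) ℂ :=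
  Matrix.vecMulVec ψ (star ψ)

/-- Pure product states: `|ψ⟩⟨ψ|` with `ψ = x₁ ⊗ ⋯ ⊗ xₙ` for unit vectors `xₖ ∈ ℂ²`. -/
def IsPureProductState {n : ℕ} (σ : Matrix (Idx n) (Idx n) ℂ) : Prop :=
  ∃ x : Fin n → EuclideanSpace ℂ (Fin 2), (∀ k, ‖x k‖ = 1) ∧ σ = rankOne (productVec x)

/-- (Full) separability: a finite combination of pure product states with nonnegative weights.
As pure product states have trace one, the weights add up to the trace of `ρ`; so for `ρ` of trace
one these are the convex combinations of pure product states (`isSeparable_iff_mem_convexHull`). -/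
def IsSeparable {n : ℕ} (ρ : Matrix (Idx n) (Idx n) ℂ) : Prop :=
  ∃ (m : ℕ) (p : Fin m → ℝ) (σ : Fin m → Matrix (Idx n) (Idx n) ℂ),
    (∀ l, 0 ≤ p l) ∧ (∀ l, IsPureProductState (σ l)) ∧ ρ = ∑ l, p l • σ l

theorem IsPureProductState.trace_eq {n : ℕ} {σ : Matrix (Idx n) (Idx n) ℂ}
    (h : IsPureProductState σ) : σ.trace = 1 := by
  obtain ⟨x, hx, rfl⟩ := h
  have h1 : ∀ k, ∑ b : Fin 2, x k b * star (x k b) = 1 := by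
    intro k
    have h2 := EuclideanSpace.norm_sq_eq (x k)
    rw [hx k] at h2
    have h3 : ∀ b, x k b * star (x k b) = ((‖x k b‖ ^ 2 : ℝ) : ℂ) := by
      intro b
      rw [Complex.star_def, Complex.mul_conj, Complex.normSq_eq_norm_sq]
    simp_rw [h3]
    rw [← Complex.ofReal_sum, ← h2]
    simp
  simp only [Matrix.trace, Matrix.diag, rankOne, Matrix.vecMulVec_apply, Pi.star_apply, productVec,
    star_prod, ← Finset.prod_mul_distrib]
  rw [← Fintype.prod_sum (fun k b => x k b * star (x k b))]
  exact Finset.prod_eq_one fun k _ => h1 k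

/-- On matrices of trace one, separability is membership in the convex hull of pure product
states. -/
theorem isSeparable_iff_mem_convexHull {n : ℕ} {ρ : Matrix (Idx n) (Idx n) ℂ} (hρ : ρ.trace = 1) :
    IsSeparable ρ ↔
      ρ ∈ convexHull ℝ {σ : Matrix (Idx n) (Idx n) ℂ | IsPureProductState σ} := by
  constructor
  · rintro ⟨m, p, σ, hp, hσ, rfl⟩
    have hsum : ∑ l, p l = 1 := by
      simp only [Matrix.trace_sum, Matrix.trace_smul, (hσ _).trace_eq] at hρ
      simp only [Complex.real_smul, mul_one] at hρ
      exact_mod_cast hρ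
    exact (convex_convexHull ℝ _).sum_mem (fun l _ => hp l) hsum
      (fun l _ => subset_convexHull ℝ _ (hσ l))
  · intro h
    obtain ⟨ι, _, p, σ, hp, _, hσ, rfl⟩ := mem_convexHull_iff_exists_fintype.1 h
    let e := Fintype.equivFin ι
    refine ⟨Fintype.card ι, p ∘ e.symm, σ ∘ e.symm, fun l => hp _, fun l => hσ _, ?_⟩
    exact (Equiv.sum_comp e.symm (fun l => p l • σ l)).symm

end XState

end

namespace XState

/-! ### Switching digits and monomials. -/

variable {n : ℕ}

/-! For a product vector with all coordinates nonzero, the diagonal and the anti-diagonal of its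
projection are `P r^i` and `P α^i` with the same `P = ∏ₖ |xₖ(0) xₖ(1)|`; here `rₖ = |xₖ(0)/xₖ(1)|`,
and `αₖ` is the phase of `xₖ(0) conj(xₖ(1))`. Hence pairing the diagonal with `s` gives at least `P
δ(s)`, and pairing the anti-diagonal with `u` at most `P ‖u‖`. Summed over a separable
decomposition, this puts `∑ pₗ Pₗ` between `‖c‖'` and `Δ(a)`.

Conversely, Hahn-Banach gives an entangled `X(a, c)` of positive trace a witness `f`
(`exists_witness`), which on X-shaped matrices reads `⟨s, a⟩ - ⟨u, c⟩` (`exists_apply_xMatrix`). A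
sign twirl (`sum_rankOne_signTwist`) shows `f ≥ 0` on X-parts of product projections. As `r` and `α`
vary independently, `‖u‖ ≤ δ(s)`, so `⟨u, c⟩ ≤ ‖u‖ ‖c‖' ≤ δ(s) Δ(a) ≤ ⟨s, a⟩`, contradicting `f(ρ) <
0`. -/

@[simp]
theorem flip_flip (i : Idx n) : flip (flip i) = i := by
  funext k
  simp only [flip]
  generalize i k = b
  fin_cases b <;> rfl

theorem flip_ne_self (hn : 1 ≤ n) (i : Idx n) : flip i ≠ i := by
  intro h
  have h1 := congrFun h ⟨0, hn⟩
  simp only [flip] at h1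
  generalize i ⟨0, hn⟩ = b at h1
  fin_cases b <;> simp at h1

/-- Switching digits as a permutation of the indices. -/
def flipEquiv (n : ℕ) : Idx n ≃ Idx n := ⟨flip, flip, flip_flip, flip_flip⟩

theorem sum_flip {M : Type*} [AddCommMonoid M] (g : Idx n → M) :
    ∑ i, g (flip i) = ∑ i, g i :=
  Equiv.sum_comp (flipEquiv n) g

theorem monom_eq_prod {K : Type*} [Field K] (z : Fin n → K) (i : Idx n) :
    monom z i = ∏ k, (if i k = 0 then z k else (z k)⁻¹) := by
  unfold monom
  refine Finset.prod_congr rfl fun k _ => ?_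
  generalize i k = b
  fin_cases b <;> simp

theorem monom_flip {K : Type*} [Field K] (z : Fin n → K) (i : Idx n) :
    monom z (flip i) = (monom z i)⁻¹ := by
  rw [monom_eq_prod, monom_eq_prod, ← Finset.prod_inv_distrib]
  refine Finset.prod_congr rfl fun k _ => ?_
  obtain h | h : i k = 0 ∨ i k = 1 := by lia
  all_goals simp [flip, h]

theorem monom_pos {r : Fin n → ℝ} (hr : ∀ k, 0 < r k) (i : Idx n) : 0 < monom r i :=
  Finset.prod_pos fun k _ => zpow_pos (hr k) _

theorem norm_monom {α : Fin n → ℂ} (hα : ∀ k, ‖α k‖ = 1) (i : Idx n) : ‖monom α i‖ = 1 := by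
  unfold monom
  rw [norm_prod]
  exact Finset.prod_eq_one fun k _ => by rw [norm_zpow, hα, one_zpow]

theorem star_monom {α : Fin n → ℂ} (hα : ∀ k, ‖α k‖ = 1) (i : Idx n) :
    star (monom α i) = monom α (flip i) := by
  rw [monom_flip]
  exact (Complex.inv_eq_conj (norm_monom hα i)).symm

/-! ### The function `δ` -/

theorem bddBelow_delta {s : Idx n → ℝ} (hs : s ∈ nonnegFun n) :
    BddBelow {t : ℝ | ∃ r : Fin n → ℝ, (∀ k, 0 < r k) ∧ t = ∑ i, s i * monom r i} := by
  refine ⟨0, ?_⟩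
  rintro t ⟨r, hr, rfl⟩
  exact Finset.sum_nonneg fun i _ => mul_nonneg (hs i) (monom_pos hr i).le

theorem delta_le {s : Idx n → ℝ} (hs : s ∈ nonnegFun n) {r : Fin n → ℝ} (hr : ∀ k, 0 < r k) :
    delta s ≤ ∑ i, s i * monom r i :=
  csInf_le (bddBelow_delta hs) ⟨r, hr, rfl⟩

theorem le_delta {s : Idx n → ℝ} {t : ℝ}
    (h : ∀ r : Fin n → ℝ, (∀ k, 0 < r k) → t ≤ ∑ i, s i * monom r i) : t ≤ delta s := by
  refine le_csInf ⟨_, fun _ => 1, fun _ => one_pos, rfl⟩ ?_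
  rintro _ ⟨r, hr, rfl⟩
  exact h r hr

theorem delta_smul {s : Idx n → ℝ} (hs : s ∈ nonnegFun n) {t : ℝ} (ht : 0 < t) :
    delta (fun i => t * s i) = t * delta s := by
  have hts : (fun i => t * s i) ∈ nonnegFun n := fun i => mul_nonneg ht.le (hs i)
  have hsum : ∀ r : Fin n → ℝ, ∑ i, t * s i * monom r i = t * ∑ i, s i * monom r i := by
    intro r
    simp only [Finset.mul_sum, mul_assoc]
  refine le_antisymm ?_ (le_delta fun r hr => ?_)
  · rw [← div_le_iff₀' ht]
    refine le_delta fun r hr => ?_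
    rw [div_le_iff₀' ht, ← hsum]
    exact delta_le hts hr
  · rw [hsum]
    exact mul_le_mul_of_nonneg_left (delta_le hs hr) ht.le

/-- Makes the infimum in `Delta` range over a nonempty set. For a constant function, pairing `i`
with `flip i` and using `t + t⁻¹ ≥ 2` shows that the minimum is at `r = 1`. -/
theorem exists_delta_eq_one (n : ℕ) : ∃ s ∈ nonnegFun n, delta s = 1 := by
  have h2 : (0 : ℝ) < 2 ^ n := by positivity
  have hs : (fun _ => ((2 : ℝ) ^ n)⁻¹) ∈ nonnegFun n := fun _ => by positivity
  have hcard : ∑ _i : Idx n, (1 : ℝ) = 2 ^ n := by simp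
  refine ⟨_, hs, le_antisymm ?_ (le_delta fun r hr => ?_)⟩
  · refine (delta_le hs (r := fun _ => 1) fun _ => one_pos).trans_eq ?_
    simp only [monom, one_zpow, Finset.prod_const_one]
    rw [← Finset.mul_sum, hcard, inv_mul_cancel₀ h2.ne']
  · rw [← Finset.mul_sum, ← div_eq_inv_mul, le_div_iff₀ h2, one_mul]
    have h3 : ∑ i, (monom r i + monom r (flip i)) = 2 * ∑ i, monom r i := by
      rw [Finset.sum_add_distrib, sum_flip (monom r)]
      ring
    have h4 : ∑ _i : Idx n, (2 : ℝ) ≤ ∑ i, (monom r i + monom r (flip i)) := by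
      refine Finset.sum_le_sum fun i _ => ?_
      have hp := monom_pos hr i
      rw [monom_flip]
      have h5 : monom r i * (monom r i)⁻¹ = 1 := mul_inv_cancel₀ hp.ne'
      nlinarith [sq_nonneg (monom r i - (monom r i)⁻¹), inv_pos.2 hp]
    have h6 : ∑ _i : Idx n, (2 : ℝ) = 2 * ∑ _i : Idx n, (1 : ℝ) := by
      rw [Finset.mul_sum]; simp
    rw [h3, h6, hcard] at h4
    linarith

theorem Delta_nonneg {a : Idx n → ℝ} (ha : a ∈ nonnegFun n) : 0 ≤ Delta a := by
  refine Real.sInf_nonneg ?_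
  rintro _ ⟨s, hs, -, rfl⟩
  exact Finset.sum_nonneg fun i _ => mul_nonneg (hs i) (ha i)

theorem delta_mul_Delta_le {a s : Idx n → ℝ} (ha : a ∈ nonnegFun n) (hs : s ∈ nonnegFun n)
    (hpos : 0 < delta s) : delta s * Delta a ≤ ∑ i, s i * a i := by
  have hinv : 0 < (delta s)⁻¹ := inv_pos.2 hpos
  have h : Delta a ≤ ∑ i, (delta s)⁻¹ * s i * a i := by
    refine csInf_le ⟨0, ?_⟩ ⟨_, fun i => mul_nonneg hinv.le (hs i), ?_, rfl⟩
    · rintro _ ⟨s, hs, -, rfl⟩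
      exact Finset.sum_nonneg fun i _ => mul_nonneg (hs i) (ha i)
    · rw [delta_smul hs hinv, inv_mul_cancel₀ hpos.ne']
  simp only [mul_assoc, ← Finset.mul_sum] at h
  rwa [← div_eq_inv_mul, le_div_iff₀' hpos] at h

/-! ### The norm and its dual -/

theorem bddAbove_xNorm (u : Idx n → ℂ) :
    BddAbove {t : ℝ | ∃ α : Fin n → ℂ, (∀ k, ‖α k‖ = 1) ∧ t = (∑ i, u i * monom α i).re} := by
  refine ⟨∑ i, ‖u i‖, ?_⟩
  rintro _ ⟨α, hα, rfl⟩
  refine (Complex.re_le_norm _).trans ((norm_sum_le _ _).trans_eq ?_)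
  simp only [norm_mul, norm_monom hα, mul_one]

theorem le_xNorm (u : Idx n → ℂ) {α : Fin n → ℂ} (hα : ∀ k, ‖α k‖ = 1) :
    (∑ i, u i * monom α i).re ≤ xNorm u :=
  le_csSup (bddAbove_xNorm u) ⟨α, hα, rfl⟩

theorem xNorm_le {u : Idx n → ℂ} {t : ℝ}
    (h : ∀ α : Fin n → ℂ, (∀ k, ‖α k‖ = 1) → (∑ i, u i * monom α i).re ≤ t) : xNorm u ≤ t := by
  refine csSup_le ⟨_, fun _ => 1, fun _ => norm_one, rfl⟩ ?_
  rintro _ ⟨α, hα, rfl⟩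
  exact h α hα

theorem xNorm_smul (u : Idx n → ℂ) {t : ℝ} (ht : 0 < t) :
    xNorm (fun i => (t : ℂ) * u i) = t * xNorm u := by
  have hsum : ∀ α : Fin n → ℂ,
      (∑ i, t * u i * monom α i).re = t * (∑ i, u i * monom α i).re := by
    intro α
    simp only [mul_assoc, ← Finset.mul_sum, Complex.re_ofReal_mul]
  refine le_antisymm (xNorm_le fun α hα => ?_) ?_
  · rw [hsum]
    exact mul_le_mul_of_nonneg_left (le_xNorm u hα) ht.le
  · rw [← le_div_iff₀' ht]
    refine xNorm_le fun α hα => ?_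
    rw [le_div_iff₀' ht, ← hsum]
    exact le_xNorm _ hα

theorem im_sum_monom {u : Idx n → ℂ} (hu : u ∈ saFun n) {α : Fin n → ℂ} (hα : ∀ k, ‖α k‖ = 1) :
    (∑ i, u i * monom α i).im = 0 := by
  rw [← Complex.conj_eq_iff_im, map_sum, ← sum_flip (fun i => u i * monom α i)]
  refine Finset.sum_congr rfl fun i _ => ?_
  rw [hu i, ← star_monom hα, map_mul]
  rfl

/-- Negating a single coordinate of `α` negates every monomial, so the supremum also bounds the
absolute value of the real sum. -/
theorem norm_sum_monom_le (hn : 1 ≤ n) {u : Idx n → ℂ} (hu : u ∈ saFun n) {α : Fin n → ℂ}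
    (hα : ∀ k, ‖α k‖ = 1) : ‖∑ i, u i * monom α i‖ ≤ xNorm u := by
  have hβ : ∀ k, ‖(Function.update α ⟨0, hn⟩ (-α ⟨0, hn⟩)) k‖ = 1 := by
    intro k
    by_cases hk : k = ⟨0, hn⟩
    · subst hk
      simp [hα]
    · simp [Function.update_of_ne hk, hα]
  have hneg : ∀ i, monom (Function.update α ⟨0, hn⟩ (-α ⟨0, hn⟩)) i = -monom α i := by
    intro i
    rw [monom_eq_prod, monom_eq_prod, ← Finset.mul_prod_erase _ _ (Finset.mem_univ ⟨0, hn⟩),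
      ← Finset.mul_prod_erase _ _ (Finset.mem_univ ⟨0, hn⟩), ← neg_mul]
    congr 1
    · simp only [Function.update_self]
      split_ifs <;> simp [inv_neg]
    · refine Finset.prod_congr rfl fun k hk => ?_
      rw [Function.update_of_ne (Finset.ne_of_mem_erase hk)]
  have h1 := le_xNorm u hα
  have h2 := le_xNorm u hβ
  simp only [hneg, mul_neg, Finset.sum_neg_distrib, Complex.neg_re] at h2
  rw [← Complex.abs_re_eq_norm.2 (im_sum_monom hu hα)]
  exact abs_le'.2 ⟨h1, h2⟩

/-- The points of `{1, I}ⁿ`, on which the monomials are orthogonal. -/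
def quarterPoint (e : Idx n) : Fin n → ℂ := fun k => if e k = 0 then 1 else Complex.I

theorem norm_quarterPoint (e : Idx n) (k : Fin n) : ‖quarterPoint e k‖ = 1 := by
  unfold quarterPoint
  split_ifs <;> simp

/-- The sum factors over the digits: equal digits contribute `1 + 1`, distinct ones `1 + I ^ 2` or
`1 + I ^ (-2)`, which vanish. -/
theorem sum_quarterPoint (i j : Idx n) :
    ∑ e : Idx n, monom (quarterPoint e) i * monom (quarterPoint e) (flip j) =
      if i = j then 2 ^ n else 0 := by
  simp only [monom_eq_prod, ← Finset.prod_mul_distrib]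
  simp only [quarterPoint]
  rw [← Fintype.prod_sum (fun k (b : Fin 2) =>
    (if i k = 0 then (if b = 0 then 1 else Complex.I) else (if b = 0 then 1 else Complex.I)⁻¹) *
    (if flip j k = 0 then (if b = 0 then 1 else Complex.I)
      else (if b = 0 then 1 else Complex.I)⁻¹))]
  have hk : ∀ k, (∑ b : Fin 2,
    (if i k = 0 then (if b = 0 then 1 else Complex.I) else (if b = 0 then 1 else Complex.I)⁻¹) *
    (if flip j k = 0 then (if b = 0 then 1 else Complex.I)
      else (if b = 0 then 1 else Complex.I)⁻¹)) = if i k = j k then 2 else 0 := by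
    intro k
    obtain h | h : i k = 0 ∨ i k = 1 := by lia
    all_goals
      obtain h' | h' : j k = 0 ∨ j k = 1 := by lia
      all_goals norm_num [Fin.sum_univ_two, flip, h, h', show (1 + 1 : Fin 2) = 0 from rfl]
  simp only [hk]
  split_ifs with h
  · subst h; simp
  · obtain ⟨k, hk⟩ := Function.ne_iff.1 h
    exact Finset.prod_eq_zero (Finset.mem_univ k) (if_neg hk)

/-- Orthogonality recovers each coefficient as an average over quarter points. This gives
definiteness of `xNorm` and finiteness of the dual norm. -/
theorem norm_apply_le_xNorm (hn : 1 ≤ n) {u : Idx n → ℂ} (hu : u ∈ saFun n) (j : Idx n) :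
    ‖u j‖ ≤ xNorm u := by
  have h2 : (0 : ℝ) < 2 ^ n := by positivity
  have h : ∑ e : Idx n, (∑ i, u i * monom (quarterPoint e) i) * monom (quarterPoint e) (flip j) =
      2 ^ n * u j := by
    simp only [Finset.sum_mul]
    rw [Finset.sum_comm]
    simp only [mul_assoc, ← Finset.mul_sum, sum_quarterPoint]
    simp [mul_comm]
  have h3 : ‖(2 : ℂ) ^ n * u j‖ ≤ 2 ^ n * xNorm u := by
    rw [← h]
    refine (norm_sum_le _ _).trans ?_
    calc _ ≤ ∑ _e : Idx n, xNorm u := Finset.sum_le_sum fun e _ => by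
            rw [norm_mul, norm_monom (norm_quarterPoint e), mul_one]
            exact norm_sum_monom_le hn hu (norm_quarterPoint e)
      _ = _ := by simp
  rw [norm_mul, norm_pow, Complex.norm_ofNat] at h3
  exact le_of_mul_le_mul_left h3 h2

theorem bddAbove_xDualNorm (hn : 1 ≤ n) (c : Idx n → ℂ) :
    BddAbove {t : ℝ | ∃ u ∈ saFun n, xNorm u = 1 ∧ t = (∑ i, u i * c i).re} := by
  refine ⟨∑ i, ‖c i‖, ?_⟩
  rintro _ ⟨u, hu, hu1, rfl⟩
  refine (Complex.re_le_norm _).trans ((norm_sum_le _ _).trans (Finset.sum_le_sum fun i _ => ?_))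
  rw [norm_mul]
  exact mul_le_of_le_one_left (norm_nonneg _) (hu1 ▸ norm_apply_le_xNorm hn hu i)

theorem re_sum_mul_le (hn : 1 ≤ n) {u : Idx n → ℂ} (hu : u ∈ saFun n) (hpos : 0 < xNorm u)
    (c : Idx n → ℂ) : (∑ i, u i * c i).re ≤ xNorm u * xDualNorm c := by
  have hinv : 0 < (xNorm u)⁻¹ := inv_pos.2 hpos
  have h : (∑ i, ((xNorm u)⁻¹ : ℝ) * u i * c i).re ≤ xDualNorm c := by
    refine le_csSup (bddAbove_xDualNorm hn c) ⟨_, fun i => ?_, ?_, rfl⟩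
    · simp only [hu i, star_mul', Complex.star_def, Complex.conj_ofReal]
    · rw [xNorm_smul u hinv, inv_mul_cancel₀ hpos.ne']
  simp only [mul_assoc, ← Finset.mul_sum, Complex.re_ofReal_mul] at h
  rwa [← div_eq_inv_mul, div_le_iff₀' hpos] at h

/-! ### The X-part of a product vector -/

/-- The diagonal of `|ψ⟩⟨ψ|` for `ψ = x₁ ⊗ ⋯ ⊗ xₙ`. -/
noncomputable def diagPart (x : Fin n → EuclideanSpace ℂ (Fin 2)) : Idx n → ℝ :=
  fun i => ∏ k, ‖x k (i k)‖ ^ 2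

/-- The anti-diagonal of `|ψ⟩⟨ψ|` for `ψ = x₁ ⊗ ⋯ ⊗ xₙ`. -/
noncomputable def antiPart (x : Fin n → EuclideanSpace ℂ (Fin 2)) : Idx n → ℂ :=
  fun i => ∏ k, x k (i k) * star (x k (flip i k))

/-- The common scale `∏ₖ |xₖ(0) xₖ(1)|` of the diagonal and anti-diagonal parts. -/
noncomputable def scale (x : Fin n → EuclideanSpace ℂ (Fin 2)) : ℝ :=
  ∏ k, (‖x k 0‖ * ‖x k 1‖)

theorem scale_nonneg (x : Fin n → EuclideanSpace ℂ (Fin 2)) : 0 ≤ scale x :=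
  Finset.prod_nonneg fun _ _ => mul_nonneg (norm_nonneg _) (norm_nonneg _)

theorem rankOne_productVec_apply (x : Fin n → EuclideanSpace ℂ (Fin 2)) (i j : Idx n) :
    rankOne (productVec x) i j = ∏ k, x k (i k) * star (x k (j k)) := by
  simp only [rankOne, Matrix.vecMulVec_apply, Pi.star_apply, productVec, star_prod,
    Finset.prod_mul_distrib]

theorem rankOne_productVec_diag (x : Fin n → EuclideanSpace ℂ (Fin 2)) (i : Idx n) :
    rankOne (productVec x) i i = diagPart x i := by
  rw [rankOne_productVec_apply, diagPart, Complex.ofReal_prod]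
  refine Finset.prod_congr rfl fun k _ => ?_
  rw [Complex.star_def, Complex.mul_conj, Complex.normSq_eq_norm_sq]

theorem rankOne_productVec_flip (x : Fin n → EuclideanSpace ℂ (Fin 2)) (i : Idx n) :
    rankOne (productVec x) i (flip i) = antiPart x i :=
  rankOne_productVec_apply x i (flip i)

theorem diagPart_nonneg (x : Fin n → EuclideanSpace ℂ (Fin 2)) (i : Idx n) : 0 ≤ diagPart x i :=
  Finset.prod_nonneg fun _ _ => by positivity

theorem diagPart_eq {x : Fin n → EuclideanSpace ℂ (Fin 2)} {r : Fin n → ℝ}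
    (hr : ∀ k, 0 < r k) (hx : ∀ k, ‖x k 0‖ = r k * ‖x k 1‖) (i : Idx n) :
    diagPart x i = scale x * monom r i := by
  rw [diagPart, scale, monom_eq_prod, ← Finset.prod_mul_distrib]
  refine Finset.prod_congr rfl fun k _ => ?_
  have := (hr k).ne'
  obtain h | h : i k = 0 ∨ i k = 1 := by lia
  · simp only [h, if_true, hx k]; ring
  · simp only [h, one_ne_zero, if_false, hx k]; field_simp

theorem antiPart_eq {x : Fin n → EuclideanSpace ℂ (Fin 2)} {α : Fin n → ℂ}
    (hα : ∀ k, ‖α k‖ = 1)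
    (hx : ∀ k, x k 0 * star (x k 1) = (‖x k 0‖ * ‖x k 1‖ : ℝ) * α k) (i : Idx n) :
    antiPart x i = scale x * monom α i := by
  rw [antiPart, scale, monom_eq_prod, Complex.ofReal_prod, ← Finset.prod_mul_distrib]
  refine Finset.prod_congr rfl fun k _ => ?_
  obtain h | h : i k = 0 ∨ i k = 1 := by lia
  · simp only [flip, h, if_true, zero_add]
    exact hx k
  · have h1 := congrArg star (hx k)
    have h2 : (1 + 1 : Fin 2) = 0 := rfl
    simp only [flip, h, one_ne_zero, if_false, h2]
    rw [star_mul, star_star, star_mul, mul_comm] at h1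
    rw [Complex.inv_eq_conj (hα k), mul_comm, mul_comm (Complex.ofReal _)]
    simpa [mul_comm] using h1

theorem scale_mul_delta_le {s : Idx n → ℝ} (hs : s ∈ nonnegFun n)
    (x : Fin n → EuclideanSpace ℂ (Fin 2)) :
    scale x * delta s ≤ ∑ i, s i * diagPart x i := by
  by_cases h0 : scale x = 0
  · rw [h0, zero_mul]
    exact Finset.sum_nonneg fun i _ => mul_nonneg (hs i) (diagPart_nonneg x i)
  · have h1 : ∀ k, ‖x k 0‖ * ‖x k 1‖ ≠ 0 := fun k =>
      Finset.prod_ne_zero_iff.1 h0 k (Finset.mem_univ k)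
    have hr : ∀ k, 0 < ‖x k 0‖ / ‖x k 1‖ := fun k =>
      div_pos ((norm_nonneg _).lt_of_ne' (left_ne_zero_of_mul (h1 k)))
        ((norm_nonneg _).lt_of_ne' (right_ne_zero_of_mul (h1 k)))
    have h2 : ∀ i, diagPart x i = scale x * monom (fun k => ‖x k 0‖ / ‖x k 1‖) i :=
      diagPart_eq hr fun k => (div_mul_cancel₀ _ (right_ne_zero_of_mul (h1 k))).symm
    simp only [h2, mul_left_comm _ (scale x), ← Finset.mul_sum]
    exact mul_le_mul_of_nonneg_left (delta_le hs hr) (scale_nonneg x)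

theorem re_sum_mul_antiPart_le (u : Idx n → ℂ) (x : Fin n → EuclideanSpace ℂ (Fin 2)) :
    (∑ i, u i * antiPart x i).re ≤ scale x * xNorm u := by
  -- A unit phase exists even for `z = 0`, so vanishing coordinates need no separate case.
  have h : ∀ z : ℂ, ∃ α : ℂ, ‖α‖ = 1 ∧ z = ‖z‖ * α := fun z =>
    ⟨Complex.exp (z.arg * Complex.I), Complex.norm_exp_ofReal_mul_I _,
      (Complex.norm_mul_exp_arg_mul_I z).symm⟩
  choose α hα hα' using fun k => h (x k 0 * star (x k 1))
  have h2 : ∀ i, antiPart x i = scale x * monom α i :=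
    antiPart_eq hα fun k => by
      conv_lhs => rw [hα' k]
      rw [norm_mul, norm_star]
  simp only [h2, mul_left_comm _ (scale x : ℂ), ← Finset.mul_sum, Complex.re_ofReal_mul]
  exact mul_le_mul_of_nonneg_left (le_xNorm u hα) (scale_nonneg x)

/-! ### Necessity -/

theorem xDualNorm_le_Delta_of_isSeparable (hn : 1 ≤ n) {a : Idx n → ℝ} {c : Idx n → ℂ}
    (h : IsSeparable (xMatrix a c)) : xDualNorm c ≤ Delta a := by
  obtain ⟨m, p, σ, hp, hσ, h⟩ := h
  choose x _ hxσ using hσ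
  have ha : ∀ i, a i = ∑ l, p l * diagPart (x l) i := by
    intro i
    have h1 := congrFun (congrFun h i) i
    simp only [xMatrix, Matrix.of_apply, if_true, Matrix.sum_apply, Matrix.smul_apply, hxσ,
      rankOne_productVec_diag, Complex.real_smul] at h1
    exact_mod_cast h1
  have hc : ∀ i, c i = ∑ l, p l * antiPart (x l) i := by
    intro i
    have h1 := congrFun (congrFun h i) (flip i)
    simpa only [xMatrix, Matrix.of_apply, if_true, if_neg (flip_ne_self hn i), Matrix.sum_apply,
      Matrix.smul_apply, hxσ, rankOne_productVec_flip, Complex.real_smul] using h1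
  have hP : 0 ≤ ∑ l, p l * scale (x l) :=
    Finset.sum_nonneg fun l _ => mul_nonneg (hp l) (scale_nonneg _)
  -- The total scale separates the two sides.
  refine le_trans (b := ∑ l, p l * scale (x l)) (Real.sSup_le ?_ hP) (le_csInf ?_ ?_)
  · rintro _ ⟨u, -, hu, rfl⟩
    have h1 : ∑ i, u i * c i = ∑ l, (p l : ℂ) * ∑ i, u i * antiPart (x l) i := by
      simp only [hc, Finset.mul_sum]
      rw [Finset.sum_comm]
      exact Finset.sum_congr rfl fun l _ => Finset.sum_congr rfl fun i _ => mul_left_comm _ _ _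
    simp only [h1, Complex.re_sum, Complex.re_ofReal_mul]
    refine Finset.sum_le_sum fun l _ => mul_le_mul_of_nonneg_left ?_ (hp l)
    simpa only [hu, mul_one, Complex.re_sum] using re_sum_mul_antiPart_le u (x l)
  · obtain ⟨s, hs, hs1⟩ := exists_delta_eq_one n
    exact ⟨_, s, hs, hs1, rfl⟩
  · rintro _ ⟨s, hs, hs1, rfl⟩
    have h1 : ∑ i, s i * a i = ∑ l, p l * ∑ i, s i * diagPart (x l) i := by
      simp only [ha, Finset.mul_sum]
      rw [Finset.sum_comm]
      exact Finset.sum_congr rfl fun l _ => Finset.sum_congr rfl fun i _ => mul_left_comm _ _ _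
    rw [h1]
    refine Finset.sum_le_sum fun l _ => mul_le_mul_of_nonneg_left ?_ (hp l)
    simpa only [hs1, mul_one] using scale_mul_delta_le hs (x l)

/-! ### Twirling by signs -/

/-- The sign `±1` attached to a digit. -/
noncomputable def sign (b : Fin 2) : ℝ := if b = 0 then 1 else -1

/-- The second coordinate of each factor multiplied by a sign. -/
noncomputable def signTwist (θ : Idx n) (x : Fin n → EuclideanSpace ℂ (Fin 2)) :
    Fin n → EuclideanSpace ℂ (Fin 2) :=
  fun k => !₂[x k 0, sign (θ k) * x k 1]

/-- The plain sum over signs keeps the entries whose digits all agree; weighting by `∏ k, sign (θ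
k)` keeps those whose digits all differ. Together they are the diagonal and the anti-diagonal, with
total weights that are nonnegative. -/
theorem sum_rankOne_signTwist (hn : 1 ≤ n) (x : Fin n → EuclideanSpace ℂ (Fin 2)) :
    ∑ θ : Idx n, (1 + ∏ k, sign (θ k)) • rankOne (productVec (signTwist θ x)) =
      (2 ^ n : ℝ) • xMatrix (diagPart x) (antiPart x) := by
  have hb : ∀ (y : EuclideanSpace ℂ (Fin 2)) (b b' : Fin 2),
      ∑ t : Fin 2, (!₂[y 0, sign t * y 1] : EuclideanSpace ℂ (Fin 2)) b *
        star ((!₂[y 0, sign t * y 1] : EuclideanSpace ℂ (Fin 2)) b') =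
      if b' = b then 2 * (y b * star (y b')) else 0 := by
    intro y b b'
    fin_cases b <;> fin_cases b' <;> simp [sign, two_mul]
  have hb' : ∀ (y : EuclideanSpace ℂ (Fin 2)) (b b' : Fin 2),
      ∑ t : Fin 2, sign t * ((!₂[y 0, sign t * y 1] : EuclideanSpace ℂ (Fin 2)) b *
        star ((!₂[y 0, sign t * y 1] : EuclideanSpace ℂ (Fin 2)) b')) =
      if b' = b + 1 then 2 * (y b * star (y b')) else 0 := by
    intro y b b'
    fin_cases b <;> fin_cases b' <;> simp [sign, two_mul]
  ext i j
  simp only [Matrix.sum_apply, Matrix.smul_apply, rankOne_productVec_apply, Complex.real_smul,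
    Complex.ofReal_add, Complex.ofReal_one, Complex.ofReal_prod, add_mul, one_mul,
    Finset.sum_add_distrib, ← Finset.prod_mul_distrib, signTwist]
  rw [← Fintype.prod_sum (fun k t => (!₂[x k 0, sign t * x k 1] : EuclideanSpace ℂ (Fin 2)) (i k) *
        star ((!₂[x k 0, sign t * x k 1] : EuclideanSpace ℂ (Fin 2)) (j k))),
    ← Fintype.prod_sum (fun k t => (sign t : ℂ) *
      ((!₂[x k 0, sign t * x k 1] : EuclideanSpace ℂ (Fin 2)) (i k) *
        star ((!₂[x k 0, sign t * x k 1] : EuclideanSpace ℂ (Fin 2)) (j k))))]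
  simp only [hb, hb']
  have h1 : ∏ k, (if j k = i k then 2 * (x k (i k) * star (x k (j k))) else 0) =
      if j = i then (2 : ℂ) ^ n * diagPart x i else 0 := by
    split_ifs with h
    · subst h
      simp only [if_true, ← rankOne_productVec_diag, rankOne_productVec_apply,
        Finset.prod_mul_distrib, Finset.prod_const, Finset.card_univ, Fintype.card_fin]
    · obtain ⟨k, hk⟩ := Function.ne_iff.1 h
      exact Finset.prod_eq_zero (Finset.mem_univ k) (if_neg hk)
  have h2 : ∏ k, (if j k = i k + 1 then 2 * (x k (i k) * star (x k (j k))) else 0) =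
      if j = flip i then (2 : ℂ) ^ n * antiPart x i else 0 := by
    split_ifs with h
    · subst h
      simp only [flip, if_true, antiPart,
        Finset.prod_mul_distrib, Finset.prod_const, Finset.card_univ, Fintype.card_fin]
    · obtain ⟨k, hk⟩ := Function.ne_iff.1 h
      exact Finset.prod_eq_zero (Finset.mem_univ k) (if_neg hk)
  rw [h1, h2]
  simp only [xMatrix, Matrix.of_apply]
  by_cases h : j = i
  · subst h
    simp [(flip_ne_self hn j).symm]
  · simp [h]

theorem one_add_prod_sign_nonneg (θ : Idx n) : 0 ≤ 1 + ∏ k, sign (θ k) := by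
  have h : |∏ k, sign (θ k)| = 1 := by
    rw [Finset.abs_prod]
    refine Finset.prod_eq_one fun k _ => ?_
    unfold sign
    split_ifs <;> simp
  linarith [neg_abs_le (∏ k, sign (θ k))]

theorem nonneg_apply_xPart (hn : 1 ≤ n) {f : Matrix (Idx n) (Idx n) ℂ →ₗ[ℝ] ℝ}
    (hf : ∀ x, 0 ≤ f (rankOne (productVec x))) (x : Fin n → EuclideanSpace ℂ (Fin 2)) :
    0 ≤ f (xMatrix (diagPart x) (antiPart x)) := by
  have h := congrArg f (sum_rankOne_signTwist hn x)
  rw [map_sum, map_smul, smul_eq_mul] at h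
  refine nonneg_of_mul_nonneg_right (a := 2 ^ n) ?_ (by positivity)
  rw [← h]
  refine Finset.sum_nonneg fun θ _ => ?_
  rw [map_smul]
  exact mul_nonneg (one_add_prod_sign_nonneg θ) (hf _)

/-! ### Separation -/

/-- By Carathéodory, `finrank + 1` points suffice, so the hull is a continuous image of a simplex
times a power of `K`. -/
theorem isCompact_convexHull_of_finiteDimensional {E : Type*} [AddCommGroup E] [Module ℝ E]
    [TopologicalSpace E] [ContinuousAdd E] [ContinuousSMul ℝ E] [FiniteDimensional ℝ E]
    {K : Set E} (hK : IsCompact K) : IsCompact (convexHull ℝ K) := by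
  rcases K.eq_empty_or_nonempty with rfl | ⟨z₀, hz₀⟩
  · simp
  let N := Module.finrank ℝ E + 1
  have hcompact : IsCompact (stdSimplex ℝ (Fin N) ×ˢ Set.univ.pi fun _ : Fin N => K) :=
    (isCompact_stdSimplex ℝ (Fin N)).prod (isCompact_univ_pi fun _ => hK)
  have hcont : Continuous fun q : (Fin N → ℝ) × (Fin N → E) => ∑ l, q.1 l • q.2 l := by
    fun_prop
  convert hcompact.image hcont using 1
  ext y
  constructor
  · intro hy
    obtain ⟨ι, _, z, w, hz, hind, hw, hw1, rfl⟩ := eq_pos_convex_span_of_mem_convexHull hy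
    have hcard : Fintype.card ι ≤ Fintype.card (Fin N) := by
      rw [Fintype.card_fin]
      exact hind.card_le_finrank_succ.trans (Nat.succ_le_succ (Submodule.finrank_le _))
    obtain ⟨e⟩ := Function.Embedding.nonempty_of_card_le hcard
    have h0 : ∀ l ∉ Set.range e, Function.extend e w 0 l = 0 := fun l hl =>
      Function.extend_apply' _ _ _ hl
    -- Unused slots get weight zero and the dummy point `z₀`.
    refine ⟨(Function.extend e w 0, Function.extend e z fun _ => z₀), ⟨⟨fun l => ?_, ?_⟩, ?_⟩, ?_⟩
    · by_cases hl : l ∈ Set.range e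
      · obtain ⟨i, rfl⟩ := hl
        simpa only [e.injective.extend_apply] using (hw i).le
      · exact (h0 l hl).ge
    · simpa only [e.injective.extend_apply] using
        (Fintype.sum_of_injective e e.injective w _ h0
          fun i => (e.injective.extend_apply w 0 i).symm).symm.trans hw1
    · intro l _
      by_cases hl : l ∈ Set.range e
      · obtain ⟨i, rfl⟩ := hl
        simpa only [e.injective.extend_apply] using hz ⟨i, rfl⟩
      · simpa only [Function.extend_apply' _ _ _ hl] using hz₀
    · refine (Fintype.sum_of_injective e e.injective _ _ (fun l hl => ?_) fun i => ?_).symm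
      · simp only [h0 l hl, zero_smul]
      · simp only [e.injective.extend_apply]
  · rintro ⟨⟨w, z⟩, ⟨hw, hz⟩, rfl⟩
    exact (convex_convexHull ℝ K).sum_mem (fun l _ => hw.1 l) hw.2
      fun l _ => subset_convexHull ℝ K (hz l trivial)

theorem isCompact_pureProductState (n : ℕ) :
    IsCompact {σ : Matrix (Idx n) (Idx n) ℂ | IsPureProductState σ} := by
  have hK : IsCompact (Set.univ.pi fun _ : Fin n =>
      Metric.sphere (0 : EuclideanSpace ℂ (Fin 2)) 1) :=
    isCompact_univ_pi fun _ => isCompact_sphere _ _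
  have hcont : Continuous fun x : Fin n → EuclideanSpace ℂ (Fin 2) => rankOne (productVec x) := by
    refine continuous_matrix fun i j => ?_
    simp only [rankOne_productVec_apply]
    fun_prop
  convert hK.image hcont using 1
  ext σ
  simp [IsPureProductState, eq_comm]

theorem rankOne_productVec_smul (t : Fin n → ℝ) (x : Fin n → EuclideanSpace ℂ (Fin 2)) :
    rankOne (productVec fun k => t k • x k) = (∏ k, t k ^ 2) • rankOne (productVec x) := by
  ext i j
  simp only [rankOne_productVec_apply, Matrix.smul_apply, Complex.real_smul, Complex.ofReal_prod,
    ← Finset.prod_mul_distrib]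
  refine Finset.prod_congr rfl fun k _ => ?_
  simp only [PiLp.smul_apply, Complex.real_smul, star_mul', Complex.star_def, Complex.conj_ofReal,
    Complex.ofReal_pow]
  ring

theorem nonneg_rankOne_of_nonneg {f : Matrix (Idx n) (Idx n) ℂ →ₗ[ℝ] ℝ}
    (hf : ∀ σ, IsPureProductState σ → 0 ≤ f σ) (x : Fin n → EuclideanSpace ℂ (Fin 2)) :
    0 ≤ f (rankOne (productVec x)) := by
  have h1 : ∀ y : EuclideanSpace ℂ (Fin 2), ∃ (t : ℝ) (e : EuclideanSpace ℂ (Fin 2)),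
      ‖e‖ = 1 ∧ y = t • e := by
    intro y
    by_cases hy : y = 0
    · exact ⟨0, EuclideanSpace.single 0 1, by simp, by simp [hy]⟩
    · exact ⟨‖y‖, ‖y‖⁻¹ • y, by simp [norm_smul, hy], by simp [smul_smul, hy]⟩
  choose t e he hx using fun k => h1 (x k)
  rw [show x = fun k => t k • e k from funext hx, rankOne_productVec_smul, map_smul]
  exact mul_nonneg (Finset.prod_nonneg fun k _ => sq_nonneg _) (hf _ ⟨e, he, rfl⟩)

theorem IsSeparable.smul {ρ : Matrix (Idx n) (Idx n) ℂ} (h : IsSeparable ρ) {t : ℝ} (ht : 0 ≤ t) :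
    IsSeparable (t • ρ) := by
  obtain ⟨m, p, σ, hp, hσ, rfl⟩ := h
  exact ⟨m, fun l => t * p l, σ, fun l => mul_nonneg ht (hp l), hσ, by
    simp only [Finset.smul_sum, smul_smul]⟩

theorem locallyConvexSpace_matrix (n : ℕ) : LocallyConvexSpace ℝ (Matrix (Idx n) (Idx n) ℂ) :=
  inferInstanceAs (LocallyConvexSpace ℝ (Idx n → Idx n → ℂ))

/-- An entanglement witness for a matrix which is not separable. -/
theorem exists_witness {ρ : Matrix (Idx n) (Idx n) ℂ} {t : ℝ} (ht : 0 < t) (htr : ρ.trace = t)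
    (hρ : ¬ IsSeparable ρ) : ∃ f : Matrix (Idx n) (Idx n) ℂ →ₗ[ℝ] ℝ,
      f ρ < 0 ∧ ∀ x, 0 ≤ f (rankOne (productVec x)) := by
  have := locallyConvexSpace_matrix n
  have htr1 : (t⁻¹ • ρ).trace = 1 := by
    rw [Matrix.trace_smul, htr, Complex.real_smul, ← Complex.ofReal_mul, inv_mul_cancel₀ ht.ne',
      Complex.ofReal_one]
  have hnot : t⁻¹ • ρ ∉ convexHull ℝ {σ : Matrix (Idx n) (Idx n) ℂ | IsPureProductState σ} := by
    rw [← isSeparable_iff_mem_convexHull htr1]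
    intro h
    refine hρ ?_
    simpa [smul_smul, ht.ne'] using h.smul ht.le
  obtain ⟨g, v, hgv, hv⟩ := geometric_hahn_banach_point_closed (convex_convexHull ℝ _)
    (isCompact_convexHull_of_finiteDimensional (isCompact_pureProductState n)).isClosed hnot
  -- On trace-one matrices, subtracting `v` times the trace turns the affine separation into a
  -- linear one.
  let f : Matrix (Idx n) (Idx n) ℂ →ₗ[ℝ] ℝ :=
    g.toLinearMap - v • (Complex.reLm ∘ₗ Matrix.traceLinearMap (Idx n) ℝ ℂ)
  have hf : ∀ σ, σ.trace = 1 → f σ = g σ - v := by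
    intro σ hσ
    simp [f, hσ]
  refine ⟨f, ?_, nonneg_rankOne_of_nonneg fun σ hσ => ?_⟩
  · have h1 : f (t⁻¹ • ρ) < 0 := by
      rw [hf _ htr1]
      linarith
    rw [map_smul, smul_eq_mul] at h1
    exact (pos_iff_neg_of_mul_neg h1).1 (inv_pos.2 ht)
  · rw [hf σ hσ.trace_eq]
    linarith [hv σ (subset_convexHull ℝ _ hσ)]

/-- A real linear functional restricted to X-shaped matrices. -/
theorem exists_apply_xMatrix (hn : 1 ≤ n) (f : Matrix (Idx n) (Idx n) ℂ →ₗ[ℝ] ℝ) :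
    ∃ (s : Idx n → ℝ), ∃ u ∈ saFun n, ∀ (a : Idx n → ℝ), ∀ c ∈ saFun n,
      f (xMatrix a c) = ∑ i, s i * a i - (∑ i, u i * c i).re := by
  -- Chosen so that `Re (v i * z)` is the value of the real-linear `f` on `z` placed at `(i, flip
  -- i)`. Symmetrizing `v` below leaves the real pairing with `c ∈ saFun n` unchanged.
  let v : Idx n → ℂ := fun i =>
    ⟨f (Matrix.single i (flip i) 1), -f (Matrix.single i (flip i) Complex.I)⟩
  refine ⟨fun i => f (Matrix.single i i 1), fun i => -(v i + star (v (flip i))) / 2, ?_, ?_⟩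
  · intro i
    simp only [flip_flip, star_div₀, star_neg, star_add, star_star, star_ofNat]
    rw [add_comm]
  intro a c hc
  have hdec : xMatrix a c = ∑ i, a i • Matrix.single i i (1 : ℂ) +
      ∑ i, ((c i).re • Matrix.single i (flip i) (1 : ℂ) +
        (c i).im • Matrix.single i (flip i) Complex.I) := by
    ext i j
    simp only [xMatrix, Matrix.of_apply, Matrix.add_apply, Matrix.sum_apply, Matrix.smul_apply,
      Matrix.single_apply, Complex.real_smul]
    by_cases h : j = i
    · subst h
      rw [Finset.sum_eq_single j (by simp +contextual) (by simp),
        Finset.sum_eq_zero fun k _ => ?_]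
      · simp
      · have : ¬ (k = j ∧ flip k = j) := by
          rintro ⟨rfl, h⟩
          exact flip_ne_self hn _ h
        simp [this]
    · have h0 : ∀ k, ¬ (k = i ∧ k = j) := by
        rintro k ⟨rfl, h'⟩
        exact h h'.symm
      rw [Finset.sum_eq_zero fun k _ => by simp [h0 k], zero_add,
        Finset.sum_eq_single i (by simp +contextual) (by simp)]
      by_cases h' : j = flip i
      · subst h'
        simp [flip_ne_self hn i, Complex.re_add_im]
      · simp [h, h', Ne.symm h']
  have h1 : f (xMatrix a c) =
      ∑ i, f (Matrix.single i i 1) * a i + (∑ i, v i * c i).re := by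
    rw [hdec]
    simp only [map_add, map_sum, map_smul, smul_eq_mul, Complex.re_sum, Complex.mul_re, v]
    congr 1
    · exact Finset.sum_congr rfl fun i _ => mul_comm _ _
    · exact Finset.sum_congr rfl fun i _ => by ring
  have h2 : (∑ i, star (v (flip i)) * c i).re = (∑ i, v i * c i).re := by
    rw [← sum_flip fun i => star (v (flip i)) * c i]
    simp only [flip_flip, hc _, Complex.re_sum]
    exact Finset.sum_congr rfl fun i _ => by simp [Complex.mul_re]
  have h3 : ∑ i, -(v i + star (v (flip i))) / 2 * c i =
      ((-1 / 2 : ℝ) : ℂ) * (∑ i, v i * c i + ∑ i, star (v (flip i)) * c i) := by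
    rw [← Finset.sum_add_distrib, Finset.mul_sum]
    refine Finset.sum_congr rfl fun i _ => ?_
    push_cast
    ring
  rw [h1, h3, Complex.re_ofReal_mul, Complex.add_re, h2]
  ring

theorem antiPart_mem_saFun (x : Fin n → EuclideanSpace ℂ (Fin 2)) : antiPart x ∈ saFun n := by
  intro i
  simp only [antiPart, flip_flip, star_prod, star_mul', star_star]
  exact Finset.prod_congr rfl fun k _ => mul_comm _ _

/-- Moduli and phases can be prescribed independently, which is what compares `xNorm u` with `delta
s`. -/
theorem exists_productVec {r : Fin n → ℝ} (hr : ∀ k, 0 < r k) {α : Fin n → ℂ}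
    (hα : ∀ k, ‖α k‖ = 1) : ∃ x : Fin n → EuclideanSpace ℂ (Fin 2),
      0 < scale x ∧ (∀ i, diagPart x i = scale x * monom r i) ∧
        ∀ i, antiPart x i = scale x * monom α i := by
  let x : Fin n → EuclideanSpace ℂ (Fin 2) := fun k => !₂[r k * α k, 1]
  have h0 : ∀ k, x k 0 = r k * α k := fun k => rfl
  have h1 : ∀ k, x k 1 = 1 := fun k => rfl
  have hn0 : ∀ k, ‖x k 0‖ = r k := fun k => by
    rw [h0, norm_mul, hα, mul_one, Complex.norm_real, Real.norm_of_nonneg (hr k).le]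
  have hn1 : ∀ k, ‖x k 1‖ = 1 := fun k => by rw [h1, norm_one]
  refine ⟨x, Finset.prod_pos fun k _ => ?_, diagPart_eq hr fun k => ?_, antiPart_eq hα fun k => ?_⟩
  · rw [hn0, hn1, mul_one]
    exact hr k
  · rw [hn0, hn1, mul_one]
  · rw [hn0, hn1, mul_one, h0, h1, star_one, mul_one]

theorem exists_basisVec (n : ℕ) (i : Idx n) (hn : 1 ≤ n) : ∃ x : Fin n → EuclideanSpace ℂ (Fin 2),
    (∀ j, diagPart x j = if j = i then 1 else 0) ∧ antiPart x = 0 := by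
  refine ⟨fun k => EuclideanSpace.single (i k) 1, fun j => ?_, funext fun j => ?_⟩
  · unfold diagPart
    split_ifs with h
    · subst h
      simp
    · obtain ⟨k, hk⟩ := Function.ne_iff.1 h
      exact Finset.prod_eq_zero (Finset.mem_univ k) (by simp [hk])
  · refine Finset.prod_eq_zero (Finset.mem_univ ⟨0, hn⟩) ?_
    have h1 := flip_ne_self (n := 1) le_rfl (fun _ => j ⟨0, hn⟩)
    have h2 : flip j ⟨0, hn⟩ ≠ j ⟨0, hn⟩ := fun h => h1 (funext fun _ => h)
    by_cases h : j ⟨0, hn⟩ = i ⟨0, hn⟩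
    · rw [h] at h2
      simp [h2]
    · simp [h]

/-! ### Sufficiency -/

theorem isSeparable_of_xDualNorm_le_Delta (hn : 1 ≤ n) {a : Idx n → ℝ} (ha : a ∈ nonnegFun n)
    {c : Idx n → ℂ} (hc : c ∈ saFun n) (hρ : (xMatrix a c).PosSemidef)
    (h : xDualNorm c ≤ Delta a) : IsSeparable (xMatrix a c) := by
  have htr : (xMatrix a c).trace = ((∑ i, a i : ℝ) : ℂ) := by
    simp [Matrix.trace, xMatrix]
  rcases (Finset.sum_nonneg fun i _ => ha i : 0 ≤ ∑ i, a i).eq_or_lt with h0 | hpos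
  -- A positive semidefinite matrix of trace zero vanishes and is the empty sum.
  · rw [← h0, Complex.ofReal_zero, hρ.trace_eq_zero_iff] at htr
    exact ⟨0, Fin.elim0, Fin.elim0, fun l => l.elim0, fun l => l.elim0, by simp [htr]⟩
  by_contra hsep
  obtain ⟨f, hfρ, hf⟩ := exists_witness hpos htr hsep
  obtain ⟨s, u, hu, hsu⟩ := exists_apply_xMatrix hn f
  have hx : ∀ x, (∑ i, u i * antiPart x i).re ≤ ∑ i, s i * diagPart x i := by
    intro x
    have h1 := nonneg_apply_xPart hn hf x
    rw [hsu _ _ (antiPart_mem_saFun x)] at h1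
    linarith
  -- Basis vectors have no anti-diagonal part, so they test each `s i` alone.
  have hs : s ∈ nonnegFun n := by
    intro i
    obtain ⟨x, hd, ha⟩ := exists_basisVec n i hn
    simpa [hd, ha] using hx x
  have hle : xNorm u ≤ delta s := by
    refine le_delta fun r hr => xNorm_le fun α hα => ?_
    obtain ⟨x, hpos, hd, ha⟩ := exists_productVec hr hα
    have h1 := hx x
    simp only [hd, ha, mul_left_comm _ (scale x), mul_left_comm _ (scale x : ℂ), ← Finset.mul_sum,
      Complex.re_ofReal_mul] at h1
    exact le_of_mul_le_mul_left h1 hpos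
  rw [hsu a c hc] at hfρ
  have hnn : 0 ≤ xNorm u := (norm_nonneg _).trans (norm_apply_le_xNorm hn hu 0)
  -- If `xNorm u = 0` there is nothing to normalize, but then `u = 0` and `f` is already nonnegative
  -- at the state.
  rcases hnn.eq_or_lt with hu0 | hupos
  · have hz : ∀ i, u i = 0 := fun i =>
      norm_le_zero_iff.1 (hu0 ▸ norm_apply_le_xNorm hn hu i)
    have h1 : 0 ≤ ∑ i, s i * a i := Finset.sum_nonneg fun i _ => mul_nonneg (hs i) (ha i)
    simp only [hz, zero_mul, Finset.sum_const_zero, Complex.zero_re, sub_zero] at hfρ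
    exact absurd hfρ h1.not_gt
  · have h1 := delta_mul_Delta_le ha hs (hupos.trans_le hle)
    have h2 := re_sum_mul_le hn hu hupos c
    have h3 := mul_le_mul_of_nonneg_left h hnn
    have h4 := mul_le_mul_of_nonneg_right hle (Delta_nonneg ha)
    linarith

end XState

/-- An X-shaped `n`-qubit state `ρ = X(a, c)` (positive semidefinite; no normalization of the trace
is needed) is separable if and only if `Δₙ(a) ≥ ‖c‖'_{Xₙ}`. -/
theorem theorem4p4 {n : ℕ} (hn : 1 ≤ n) (a : XState.Idx n → ℝ) (ha : a ∈ XState.nonnegFun n)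
    (c : XState.Idx n → ℂ) (hc : c ∈ XState.saFun n)
    (hρ : (XState.xMatrix a c).PosSemidef) :
    XState.IsSeparable (XState.xMatrix a c) ↔ XState.xDualNorm c ≤ XState.Delta a :=
  ⟨XState.xDualNorm_le_Delta_of_isSeparable hn,
    XState.isSeparable_of_xDualNorm_le_Delta hn ha hc hρ⟩
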